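/- Let $p$ be an odd prime and let $0<\alpha\le 1$; both are held fixed. For a subset $S$ of the finite field $\mathbb F_{p^n}$ (with $n\ge 1$) let $$\Lambda_3(S)=p^{-2n}\,\#\{(m,d)\in\mathbb F_{p^n}^2 : m,\ m+d,\ m+2d\in S\}$$ be the normalized number of three-term arithmetic progressions in $S$, the trivial ones ($d=0$) included. Suppose that $S\subseteq\mathbb F_{p^n}$ satisfies $|S|\ge\alpha p^n$ and that $\Lambda_3(S)\le\Lambda_3(T)$ for every $T\subseteq\mathbb F_{p^n}$ with $|T|\ge\alpha p^n$. Then there exist an $\mathbb F_p$-subspace $W\le\mathbb F_{p^n}$ of dimension $n-o(n)$ and a non-empty set $A\subseteq\mathbb F_{p^n}$ of size at most $p^{o(n)}$ such that $$|S\,\Delta\,(A+W)|=o(p^n).$$ Here the $o(\cdot)$ terms are as $n\to\infty$ and are uniform in $S$: there are functions $r,s,t:\mathbb N\to\mathbb R$, depending only on $p$ and $\alpha$, with $r(n)=o(n)$, $s(n)=o(n)$, $t(n)=o(p^n)$, such that for every $n\ge1$ and every such minimizer $S$ one can choose $W$ and $A$ with $\dim W\ge n-r(n)$, $1\le|A|\le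 p^{s(n)}$ and $|S\,\Delta\,(A+W)|\le t(n)$. -/

import Mathlib

open Filter Asymptotics
open scoped Pointwise symmDiff

/-- The normalized three-term progression average
`Λ₃(f) = |G|⁻² ∑_{m, d} f(m) f(m + d) f(m + 2d)` of a real function on a finite abelian group. -/
noncomputable def Lambda3 {G : Type*} [AddCommGroup G] [Fintype G] (f : G → ℝ) : ℝ :=
  ((Fintype.card G : ℝ) ^ 2)⁻¹ * ∑ m : G, ∑ d : G, f m * f (m + d) * f (m + 2 • d)

/-- `Λ₃(S)`: the normalized number of three-term progressions `m, m + d, m + 2d` in `S`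
(trivial ones, with `d = 0`, included). -/
noncomputable def Lambda3Set {G : Type*} [AddCommGroup G] [Fintype G] (S : Set G) : ℝ :=
  Lambda3 (S.indicator (fun _ => (1 : ℝ)))

/-! A minimizer cannot have coset averages that are often strictly between 0 and 1, because such
averages leave room to destroy progressions. Let `W` be the common kernel of the large spectrum of
`S`; by Parseval its codimension is bounded. Let `g` be the average of the indicator of `S` over
cosets of `W`. Then `g` has nearly the same `Lambda3` as `S` (`abs_lambda3_condAvg_sub_le`).

With `c = g (1 - g)` and `ℓ` a functional non-trivial on `W`, the function `g + c * dip p (ℓ x)`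
takes values in `[0,1]`, has the mass of `g`, and lowers `Lambda3` by a fixed multiple of `Lambda3
c` (`lambda3_add_mul_dip`). Rounding to a set of the same size costs at most `1/|V|`
(`exists_finset_lambda3_le`), so minimality forces `Lambda3 c` to be small. Varnavides' theorem
(`exists_pos_le_lambda3`) then makes the mean of `c` small, so `g` is mostly near 0 or 1 and `S` is
close to a union of cosets (`exists_union_cosets_approx`). A diagonal choice of the precision turns
this into the `o(·)` statement. -/

lemma sq_card_mul_lambda3 {G : Type*} [AddCommGroup G] [Fintype G] (f : G → ℝ) :
    (Fintype.card G : ℝ) ^ 2 * Lambda3 f = ∑ m : G, ∑ d : G, f m * f (m + d) * f (m + 2 • d) := by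
  have : (Fintype.card G : ℝ) ≠ 0 := by exact_mod_cast Fintype.card_ne_zero
  unfold Lambda3
  field_simp

lemma lambda3_mono {G : Type*} [AddCommGroup G] [Fintype G] {f g : G → ℝ}
    (hf : ∀ x, 0 ≤ f x) (hfg : ∀ x, f x ≤ g x) : Lambda3 f ≤ Lambda3 g := by
  have hg : ∀ x, 0 ≤ g x := fun x => (hf x).trans (hfg x)
  unfold Lambda3
  refine mul_le_mul_of_nonneg_left (Finset.sum_le_sum fun m _ => Finset.sum_le_sum fun d _ => ?_)
    (by positivity)
  exact mul_le_mul (mul_le_mul (hfg _) (hfg _) (hf _) (hg _)) (hfg _) (hf _)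
    (mul_nonneg (hg _) (hg _))

lemma lambda3_const_mul {G : Type*} [AddCommGroup G] [Fintype G] (a : ℝ) (f : G → ℝ) :
    Lambda3 (fun x => a * f x) = a ^ 3 * Lambda3 f := by
  unfold Lambda3
  simp_rw [Finset.mul_sum]
  exact Finset.sum_congr rfl fun m _ => Finset.sum_congr rfl fun d _ => by ring

/-! ### Varnavides' theorem from triangle removal. -/

section Varnavides

open SimpleGraph TripartiteFromTriangles Finset Sum3

variable {G : Type*} [AddCommGroup G] [Fintype G] [DecidableEq G]

/-- The triples `(x, x + s, x + 2s)` with `s ∈ A`. -/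
def progressionTriangles (A : Finset G) : Finset (G × G × G) :=
  (univ ×ˢ A).image fun q : G × G => (q.1, q.1 + q.2, q.1 + 2 • q.2)

lemma mem_progressionTriangles {A : Finset G} {x y z : G} :
    (x, y, z) ∈ progressionTriangles A ↔ y - x ∈ A ∧ z = x + 2 • (y - x) := by
  simp only [progressionTriangles, mem_image, mem_product, mem_univ, true_and, Prod.mk.injEq,
    Prod.exists]
  constructor
  · rintro ⟨a, b, hb, rfl, rfl, rfl⟩
    simpa using hb
  · rintro ⟨h, rfl⟩
    exact ⟨x, y - x, h, rfl, by abel, rfl⟩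

lemma card_progressionTriangles (A : Finset G) :
    #(progressionTriangles A) = Fintype.card G * #A := by
  rw [progressionTriangles, card_image_of_injective, card_product, card_univ]
  rintro ⟨a, b⟩ ⟨c, d⟩ h
  simp only [Prod.mk.injEq] at h
  obtain ⟨rfl, h, -⟩ := h
  simpa using h

/-- The relation `x + z = 2y` recovers any one coordinate from the other two; only recovering `y`
needs division by 2. -/
lemma explicitDisjoint_progressionTriangles (h2 : Function.Injective fun x : G => 2 • x)
    (A : Finset G) : ExplicitDisjoint (progressionTriangles A) where
  inj₀ x y z x' h h' := by
    rw [mem_progressionTriangles] at h h'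
    have := h.2.symm.trans h'.2
    have e : x' - x = 0 := by
      have : x + 2 • (y - x) - (x' + 2 • (y - x')) = 0 := by rw [this]; simp
      rw [← this]; abel
    exact (sub_eq_zero.1 e).symm
  inj₁ x y z y' h h' := by
    rw [mem_progressionTriangles] at h h'
    have := h2 (add_left_cancel (h.2.symm.trans h'.2))
    simpa using this
  inj₂ x y z z' h h' := by
    rw [mem_progressionTriangles] at h h'
    exact h.2.trans h'.2.symm

/-- The edges of a triangle `(x, y, z)` put `y - x`, `(z - x)/2` and `z - y` in `A`. These form a
progression, and together with `x` they determine the triangle. -/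
lemma card_triangles_progressionTriangles_le (A : Finset G) :
    #((graph (progressionTriangles A)).cliqueFinset 3) ≤
      Fintype.card G * #{q : G × G | q.1 ∈ A ∧ q.1 + q.2 ∈ A ∧ q.1 + 2 • q.2 ∈ A} := by
  rw [← card_univ, ← card_product]
  refine card_le_card_of_surjOn (fun q : G × G × G =>
    ({in₀ q.1, in₁ (q.1 + q.2.1), in₂ (q.1 + 2 • (q.2.1 + q.2.2))} : Finset (G ⊕ G ⊕ G))) ?_
  intro s hs
  simp only [mem_coe, mem_cliqueFinset_iff] at hs
  rw [is3Clique_iff] at hs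
  obtain ⟨x, y, z, hxy, hxz, hyz, rfl⟩ := hs
  obtain ⟨a, b, c, habc, hab, hac, hbc⟩ := graph_triple hxy hxz hyz
  obtain ⟨c', hc'⟩ := Graph.in₀₁_iff.1 hab
  obtain ⟨b', hb'⟩ := Graph.in₀₂_iff.1 hac
  obtain ⟨a', ha'⟩ := Graph.in₁₂_iff.1 hbc
  rw [mem_progressionTriangles] at ha' hb' hc'
  refine ⟨(a, b - a, (b' - a) - (b - a)), ?_, ?_⟩
  · simp only [mem_coe, mem_product, mem_univ, mem_filter, true_and]
    refine ⟨hc'.1, by simpa using hb'.1, ?_⟩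
    have e : b - a + 2 • (b' - a - (b - a)) = b - a' := by
      have := hb'.2.symm.trans ha'.2
      have e2 : a' + 2 • (b - a') - (a + 2 • (b' - a)) = 0 := by rw [this]; simp
      rw [← sub_eq_zero, ← neg_eq_zero, ← e2]; abel
    rw [e]; exact ha'.1
  · rw [← habc, hb'.2]
    simp

/-- The graph has `3N` vertices and at least `εN² = (ε/9)(3N)²` edge-disjoint triangles, so removal
gives a multiple of `(3N)³` triangles, and each progression accounts for at most `N` of them. -/
lemma triangleRemovalBound_mul_le_card_progressions (h2 : Function.Injective fun x : G => 2 • x)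
    {ε : ℝ} {A : Finset G} (hA : ε * Fintype.card G ≤ #A) :
    27 * triangleRemovalBound (ε / 9) * (Fintype.card G : ℝ) ^ 2 ≤
      #{q : G × G | q.1 ∈ A ∧ q.1 + q.2 ∈ A ∧ q.1 + 2 • q.2 ∈ A} := by
  have := explicitDisjoint_progressionTriangles h2 A
  have hN : (0 : ℝ) < Fintype.card G := by exact_mod_cast Fintype.card_pos
  have hfar : (graph (progressionTriangles A)).FarFromTriangleFree (ε / 9) := by
    refine farFromTriangleFree _ ?_
    rw [card_progressionTriangles]
    push_cast
    nlinarith [mul_le_mul_of_nonneg_left hA hN.le]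
  have h := hfar.le_card_cliqueFinset.trans
    (Nat.cast_le.2 (card_triangles_progressionTriangles_le A))
  simp only [Fintype.card_sum] at h
  push_cast at h
  refine le_of_mul_le_mul_left ?_ hN
  refine le_trans (le_of_eq ?_) h
  ring

end Varnavides

/-- **Varnavides' theorem** for functions on finite abelian groups of odd order. -/
theorem exists_pos_le_lambda3 {η : ℝ} (hη : 0 < η) : ∃ κ : ℝ, 0 < κ ∧
    ∀ (G : Type) [AddCommGroup G] [Fintype G], (Function.Injective fun x : G => 2 • x) →
      ∀ F : G → ℝ, (∀ x, 0 ≤ F x) → (∀ x, F x ≤ 1) → η * Fintype.card G ≤ ∑ x, F x →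
        κ ≤ Lambda3 F := by
  classical
  refine ⟨(η / 2) ^ 3 * (27 * SimpleGraph.triangleRemovalBound (η / 2 / 9)), ?_, ?_⟩
  · have := SimpleGraph.triangleRemovalBound_pos (ε := η / 2 / 9) (by positivity)
    positivity
  intro G _ _ h2 F hF0 hF1 hsum
  have hN : (0 : ℝ) < Fintype.card G := by exact_mod_cast Fintype.card_pos
  -- Since `F ≤ 1`, points with `F < η/2` carry too little mass, so this level set is dense; `F ≥
  -- (η/2)·1_A` then costs the factor `(η/2)³`.
  set A : Finset G := Finset.univ.filter fun x => η / 2 ≤ F x with hA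
  have hAcard : η / 2 * Fintype.card G ≤ A.card := by
    have h1 : ∑ x, F x ≤ ∑ x, ((if η / 2 ≤ F x then 1 else 0) + η / 2) := by
      refine Finset.sum_le_sum fun x _ => ?_
      split_ifs with h
      · linarith [hF1 x]
      · linarith
    rw [Finset.sum_add_distrib, Finset.sum_boole] at h1
    simp only [Finset.sum_const, Finset.card_univ, nsmul_eq_mul] at h1
    rw [hA]
    linarith
  have hcount := triangleRemovalBound_mul_le_card_progressions h2 hAcard
  set χ : G → ℝ := fun x => if x ∈ A then 1 else 0 with hχ
  have hχL : (Fintype.card G : ℝ) ^ 2 * Lambda3 χ =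
      (Finset.univ.filter fun q : G × G =>
        q.1 ∈ A ∧ q.1 + q.2 ∈ A ∧ q.1 + 2 • q.2 ∈ A).card := by
    rw [sq_card_mul_lambda3, ← Finset.sum_boole, Fintype.sum_prod_type]
    refine Finset.sum_congr rfl fun m _ => Finset.sum_congr rfl fun d _ => ?_
    by_cases h1 : m ∈ A <;> by_cases h2 : m + d ∈ A <;> by_cases h3 : m + 2 • d ∈ A <;>
      simp only [hχ, h1, h2, h3] <;> norm_num
  have hle : Lambda3 (fun x => η / 2 * χ x) ≤ Lambda3 F := by
    refine lambda3_mono (fun x => ?_) fun x => ?_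
    · simp only [hχ]; split_ifs <;> positivity
    · simp only [hχ]
      split_ifs with h
      · simpa [hA] using h
      · simpa using hF0 x
  rw [lambda3_const_mul] at hle
  refine le_trans ?_ hle
  refine mul_le_mul_of_nonneg_left ?_ (by positivity)
  rw [← hχL] at hcount
  have : 0 < (Fintype.card G : ℝ) ^ 2 := by positivity
  nlinarith

/-! ### Lowering the progression count along one direction. -/

section Perturbation

variable {p : ℕ} [Fact p.Prime]

lemma ZMod.two_ne_zero_of_ne_two (hp : p ≠ 2) : (2 : ZMod p) ≠ 0 := by
  have h := Fact.out (p := p.Prime)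
  intro h0
  have : ((2 : ℕ) : ZMod p) = 0 := by exact_mod_cast h0
  rw [ZMod.natCast_eq_zero_iff] at this
  exact hp ((Nat.prime_dvd_prime_iff_eq h Nat.prime_two).1 this)

/-- The mean zero function `1/p - 1_{0}` on `ℤ/p`. -/
noncomputable def dip (p : ℕ) (u : ZMod p) : ℝ := (p : ℝ)⁻¹ - if u = 0 then 1 else 0

lemma abs_dip_le_one (u : ZMod p) : |dip p u| ≤ 1 := by
  have h : (1 : ℝ) ≤ p := by exact_mod_cast (Fact.out (p := p.Prime)).one_le
  have h1 : (p : ℝ)⁻¹ ≤ 1 := inv_le_one_of_one_le₀ h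
  have h0 : 0 ≤ (p : ℝ)⁻¹ := by positivity
  rw [abs_le, dip]
  split_ifs <;> constructor <;> linarith

lemma sum_dip : ∑ u : ZMod p, dip p u = 0 := by
  have h : (p : ℝ) ≠ 0 := by exact_mod_cast (Fact.out (p := p.Prime)).ne_zero
  simp [dip, Finset.sum_sub_distrib, ZMod.card, h]

/-- For odd `p`, any two terms of a progression are independent, so products with one or two
mean-zero factors average out. Only the triple product survives, and its sign is negative: this is
the whole gain. -/
lemma sum_prod_add_mul_dip (hp : p ≠ 2) (a₁ a₂ a₃ c₁ c₂ c₃ : ℝ) (u v : ZMod p) :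
    ∑ s : ZMod p, ∑ t : ZMod p, (a₁ + c₁ * dip p (u + s)) * (a₂ + c₂ * dip p (u + v + s + t)) *
      (a₃ + c₃ * dip p (u + 2 * v + s + 2 * t)) =
      p ^ 2 * (a₁ * a₂ * a₃) - (1 - (p : ℝ)⁻¹) * (c₁ * c₂ * c₃) := by
  have hp0 : (p : ℝ) ≠ 0 := by exact_mod_cast (Fact.out (p := p.Prime)).ne_zero
  have h2 := ZMod.two_ne_zero_of_ne_two hp
  set δ : ZMod p → ℝ := fun x => if x = 0 then 1 else 0 with hδ
  have hδ1 : ∑ s, δ s = 1 := by simp [hδ]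
  have hδ2 : ∀ s, ∑ t, δ (s + t) = 1 := fun s => by
    rw [← hδ1]; exact Equiv.sum_comp (Equiv.addLeft s) δ
  have hδ3 : ∀ s, ∑ t, δ (s + 2 * t) = 1 := fun s => by
    rw [← hδ2 s]
    exact Equiv.sum_comp (Equiv.mulLeft₀ (2 : ZMod p) h2) fun t => δ (s + t)
  have hδ4 : ∀ s, ∑ t, δ (s + t) * δ (s + 2 * t) = δ s := fun s => by
    have : ∀ t, δ (s + t) * δ (s + 2 * t) = if t = -s then δ s else 0 := by
      intro t
      simp only [hδ]
      by_cases h : t = -s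
      · subst h
        have : s + 2 * -s = -s := by ring
        rw [this]
        simp
      · have : s + t ≠ 0 := fun h' => h (by linear_combination h')
        simp [this, h]
    simp [this]
  have hsq : ∀ s, δ s * δ s = δ s := fun s => by simp only [hδ]; split_ifs <;> simp
  have key : ∀ A₁ A₂ A₃ : ℝ, ∑ s : ZMod p, ∑ t : ZMod p, (A₁ - c₁ * δ s) * (A₂ - c₂ * δ (s + t)) *
      (A₃ - c₃ * δ (s + 2 * t)) = p ^ 2 * (A₁ * A₂ * A₃) -
        p * (A₁ * A₂ * c₃ + A₁ * c₂ * A₃ + c₁ * A₂ * A₃) +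
        (A₁ * c₂ * c₃ + c₁ * A₂ * c₃ + c₁ * c₂ * A₃) - c₁ * c₂ * c₃ := by
    intro A₁ A₂ A₃
    have inner : ∀ s, ∑ t : ZMod p, (A₁ - c₁ * δ s) * (A₂ - c₂ * δ (s + t)) *
        (A₃ - c₃ * δ (s + 2 * t)) = A₁ * (p * (A₂ * A₃) - A₂ * c₃ - c₂ * A₃) +
          (A₁ * c₂ * c₃ - c₁ * (p * (A₂ * A₃) - A₂ * c₃ - c₂ * A₃) - c₁ * c₂ * c₃) * δ s := by
      intro s
      have : ∀ t, (A₁ - c₁ * δ s) * (A₂ - c₂ * δ (s + t)) * (A₃ - c₃ * δ (s + 2 * t)) =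
          (A₁ - c₁ * δ s) * (A₂ * A₃ - A₂ * c₃ * δ (s + 2 * t) - c₂ * A₃ * δ (s + t) +
            c₂ * c₃ * (δ (s + t) * δ (s + 2 * t))) := fun t => by ring
      simp_rw [this, ← Finset.mul_sum, Finset.sum_add_distrib, Finset.sum_sub_distrib,
        ← Finset.mul_sum, hδ2, hδ3, hδ4]
      simp only [Finset.sum_const, Finset.card_univ, ZMod.card, nsmul_eq_mul]
      linear_combination (-c₁ * c₂ * c₃) * hsq s
    simp_rw [inner, Finset.sum_add_distrib, ← Finset.mul_sum, hδ1]
    simp only [Finset.sum_const, Finset.card_univ, ZMod.card, nsmul_eq_mul]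
    ring
  have shift : ∑ s : ZMod p, ∑ t : ZMod p, (a₁ + c₁ * dip p (u + s)) *
      (a₂ + c₂ * dip p (u + v + s + t)) * (a₃ + c₃ * dip p (u + 2 * v + s + 2 * t)) =
      ∑ s : ZMod p, ∑ t : ZMod p, (a₁ + c₁ * dip p s) * (a₂ + c₂ * dip p (s + t)) *
        (a₃ + c₃ * dip p (s + 2 * t)) := by
    symm
    rw [← Equiv.sum_comp (Equiv.addLeft u)]
    refine Finset.sum_congr rfl fun s _ => ?_
    rw [← Equiv.sum_comp (Equiv.addLeft v)]
    refine Finset.sum_congr rfl fun t _ => ?_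
    simp only [Equiv.coe_addLeft]
    rw [show u + s + (v + t) = u + v + s + t by ring,
      show u + s + 2 * (v + t) = u + 2 * v + s + 2 * t by ring]
  have e : ∀ a c : ℝ, ∀ x, a + c * dip p x = a + c * (p : ℝ)⁻¹ - c * δ x := fun a c x => by
    simp only [dip, hδ]; ring
  rw [shift]
  simp_rw [e]
  rw [key]
  field_simp
  ring

variable {V : Type*} [AddCommGroup V] [Module (ZMod p) V]

lemma two_nsmul_injective_of_ne_two (hp : p ≠ 2) : Function.Injective fun x : V => 2 • x := by
  intro x y hxy
  simp only [← Nat.cast_smul_eq_nsmul (ZMod p)] at hxy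
  exact smul_right_injective V (by exact_mod_cast ZMod.two_ne_zero_of_ne_two hp) hxy

variable [Fintype V]

lemma sum_mul_dip (c : V → ℝ) (ℓ : Module.Dual (ZMod p) V) (w : V)
    (hw : ℓ w = 1) (hc : ∀ (x : V) (s : ZMod p), c (x + s • w) = c x) :
    ∑ x, c x * dip p (ℓ x) = 0 := by
  have hp0 : (p : ℝ) ≠ 0 := by exact_mod_cast (Fact.out (p := p.Prime)).ne_zero
  have hshift : ∀ s : ZMod p, ∑ x, c x * dip p (ℓ x) = ∑ x, c x * dip p (ℓ x + s) := by
    intro s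
    rw [← Equiv.sum_comp (Equiv.addRight (s • w))]
    exact Finset.sum_congr rfl fun x _ => by simp [hc, hw]
  have hsum : (p : ℝ) * ∑ x, c x * dip p (ℓ x) = 0 := by
    calc (p : ℝ) * ∑ x, c x * dip p (ℓ x) = ∑ _s : ZMod p, ∑ x, c x * dip p (ℓ x) := by
          simp [ZMod.card]
      _ = ∑ x, ∑ s : ZMod p, c x * dip p (ℓ x + s) := by
          rw [Finset.sum_congr rfl fun s _ => hshift s, Finset.sum_comm]
      _ = 0 := by
          refine Finset.sum_eq_zero fun x _ => ?_
          rw [← Finset.mul_sum]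
          have h := Equiv.sum_comp (Equiv.addLeft (ℓ x)) (dip p)
          rw [sum_dip] at h
          simp only [Equiv.coe_addLeft] at h
          rw [h, mul_zero]
  exact (mul_eq_zero.1 hsum).resolve_left hp0

/-- Perturbing a function `g` invariant under `w` along a functional `ℓ` with `ℓ w = 1`. -/
theorem lambda3_add_mul_dip (hp : p ≠ 2) (g c : V → ℝ) (ℓ : Module.Dual (ZMod p) V) (w : V)
    (hw : ℓ w = 1) (hg : ∀ (x : V) (s : ZMod p), g (x + s • w) = g x)
    (hc : ∀ (x : V) (s : ZMod p), c (x + s • w) = c x) :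
    Lambda3 (fun x => g x + c x * dip p (ℓ x)) =
      Lambda3 g - ((p : ℝ) ^ 2)⁻¹ * (1 - (p : ℝ)⁻¹) * Lambda3 c := by
  have hp0 : (p : ℝ) ≠ 0 := by exact_mod_cast (Fact.out (p := p.Prime)).ne_zero
  have hN : (Fintype.card V : ℝ) ≠ 0 := by exact_mod_cast Fintype.card_ne_zero
  set h : V → ℝ := fun x => g x + c x * dip p (ℓ x) with hh
  have hhs : ∀ x s, h (x + s • w) = g x + c x * dip p (ℓ x + s) := fun x s => by
    simp [hh, hg, hc, hw]
  -- Translating `m` by `s • w` and `d` by `t • w` changes only the arguments of `dip`; averaging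
  -- over `s, t` reduces the identity to `ZMod p`.
  have hshift : ∀ s t : ZMod p, (Fintype.card V : ℝ) ^ 2 * Lambda3 h =
      ∑ m : V, ∑ d : V, (g m + c m * dip p (ℓ m + s)) *
        (g (m + d) + c (m + d) * dip p (ℓ m + ℓ d + s + t)) *
        (g (m + 2 • d) + c (m + 2 • d) * dip p (ℓ m + 2 * ℓ d + s + 2 * t)) := by
    intro s t
    rw [sq_card_mul_lambda3, ← Equiv.sum_comp (Equiv.addRight (s • w))]
    refine Finset.sum_congr rfl fun m _ => ?_
    rw [← Equiv.sum_comp (Equiv.addRight (t • w))]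
    refine Finset.sum_congr rfl fun d _ => ?_
    simp only [Equiv.coe_addRight]
    have e1 : m + s • w + (d + t • w) = (m + d) + (s + t) • w := by rw [add_smul]; abel
    have e2 : m + s • w + 2 • (d + t • w) = (m + 2 • d) + (s + 2 * t) • w := by
      rw [add_smul, two_mul, add_smul, two_nsmul, two_nsmul]; abel
    rw [e1, e2, hhs, hhs, hhs]
    simp only [map_add, map_nsmul]
    rw [nsmul_eq_mul, Nat.cast_ofNat, show ℓ m + ℓ d + (s + t) = ℓ m + ℓ d + s + t by ring,
      show ℓ m + 2 * ℓ d + (s + 2 * t) = ℓ m + 2 * ℓ d + s + 2 * t by ring]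
  have hsum : (p : ℝ) ^ 2 * ((Fintype.card V : ℝ) ^ 2 * Lambda3 h) =
      p ^ 2 * ((Fintype.card V : ℝ) ^ 2 * Lambda3 g) -
        (1 - (p : ℝ)⁻¹) * ((Fintype.card V : ℝ) ^ 2 * Lambda3 c) := by
    have : (p : ℝ) ^ 2 * ((Fintype.card V : ℝ) ^ 2 * Lambda3 h) =
        ∑ s : ZMod p, ∑ t : ZMod p, (Fintype.card V : ℝ) ^ 2 * Lambda3 h := by
      simp [ZMod.card]; ring
    rw [this, Finset.sum_congr rfl fun s _ => Finset.sum_congr rfl fun t _ => hshift s t]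
    have swap : ∀ F : ZMod p → ZMod p → V → V → ℝ, ∑ s, ∑ t, ∑ m, ∑ d, F s t m d =
        ∑ m, ∑ d, ∑ s, ∑ t, F s t m d := by
      intro F
      have h1 : ∀ s t, ∑ m, ∑ d, F s t m d = ∑ q : V × V, F s t q.1 q.2 := fun s t =>
        (Fintype.sum_prod_type' (F s t)).symm
      simp_rw [h1]
      rw [← Fintype.sum_prod_type' (fun s t => ∑ q : V × V, F s t q.1 q.2), Finset.sum_comm,
        Fintype.sum_prod_type]
      simp_rw [Fintype.sum_prod_type]
    rw [swap]
    simp_rw [sum_prod_add_mul_dip hp]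
    rw [sq_card_mul_lambda3, sq_card_mul_lambda3]
    simp_rw [Finset.mul_sum, ← Finset.sum_sub_distrib]
  field_simp at hsum ⊢
  linear_combination hsum

end Perturbation

/-! ### Fourier analysis and averaging over cosets. -/

section Fourier

open ComplexConjugate

variable {p : ℕ} [Fact p.Prime] {V : Type*} [AddCommGroup V] [Module (ZMod p) V]

/-- The additive character of `V` attached to a linear functional. -/
noncomputable def dualChar (φ : Module.Dual (ZMod p) V) : AddChar V ℂ :=
  (ZMod.stdAddChar (N := p)).compAddMonoidHom φ.toAddMonoidHom

lemma dualChar_apply (φ : Module.Dual (ZMod p) V) (x : V) :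
    dualChar φ x = ZMod.stdAddChar (φ x) := rfl

lemma dualChar_eq_one_iff {φ : Module.Dual (ZMod p) V} {x : V} : dualChar φ x = 1 ↔ φ x = 0 := by
  rw [dualChar_apply, ← AddChar.map_zero_eq_one (ZMod.stdAddChar (N := p)),
    ZMod.injective_stdAddChar.eq_iff]

lemma dualChar_smul (k : ZMod p) (φ : Module.Dual (ZMod p) V) (x : V) :
    dualChar (k • φ) x = dualChar φ (k • x) := by
  simp [dualChar_apply]

/-- The average of `f` over the cosets of `W`. -/
noncomputable def condAvg (W : Submodule (ZMod p) V) (f : V → ℝ) (x : V) : ℝ :=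
  (Nat.card W : ℝ)⁻¹ * ∑ᶠ w : W, f (x + w)

lemma condAvg_eq_sum (W : Submodule (ZMod p) V) [Fintype W] (f : V → ℝ) (x : V) :
    condAvg W f x = (Fintype.card W : ℝ)⁻¹ * ∑ w : W, f (x + w) := by
  rw [condAvg, finsum_eq_sum_of_fintype, Nat.card_eq_fintype_card]

variable [Fintype V]

lemma conj_dualChar (φ : Module.Dual (ZMod p) V) (x : V) :
    conj (dualChar φ x) = dualChar φ (-x) := by
  rw [AddChar.map_neg_eq_conj]

/-- The Fourier coefficient of `f` at a linear functional. -/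
noncomputable def fourierCoeffDual (f : V → ℝ) (φ : Module.Dual (ZMod p) V) : ℂ :=
  (Fintype.card V : ℂ)⁻¹ * ∑ x, (f x : ℂ) * dualChar φ x

noncomputable instance : Fintype (Module.Dual (ZMod p) V) :=
  @Fintype.ofFinite _ (Module.finite_of_finite (ZMod p))

lemma card_dual : Fintype.card (Module.Dual (ZMod p) V) = Fintype.card V := by
  rw [Module.card_eq_pow_finrank (K := ZMod p) (V := V),
    Module.card_eq_pow_finrank (K := ZMod p) (V := Module.Dual (ZMod p) V),
    Subspace.dual_finrank_eq]

/-- Evaluation at `x` is a character of the dual, trivial only at `x = 0` because functionals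
separate points. -/
lemma sum_dualChar [DecidableEq V] (x : V) :
    ∑ φ : Module.Dual (ZMod p) V, dualChar φ x = if x = 0 then (Fintype.card V : ℂ) else 0 := by
  classical
  have h := AddChar.sum_eq_ite ((ZMod.stdAddChar (N := p)).compAddMonoidHom
    (Module.Dual.eval (ZMod p) V x).toAddMonoidHom)
  have hiff : (ZMod.stdAddChar (N := p)).compAddMonoidHom
      (Module.Dual.eval (ZMod p) V x).toAddMonoidHom = 0 ↔ x = 0 := by
    rw [← Module.forall_dual_apply_eq_zero_iff (ZMod p) x, AddChar.eq_zero_iff]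
    exact forall_congr' fun φ => dualChar_eq_one_iff
  simp only [hiff, card_dual] at h
  exact h

/-- Parseval's identity. -/
lemma sum_norm_sq_fourierCoeffDual (f : V → ℝ) :
    ∑ φ : Module.Dual (ZMod p) V, ‖fourierCoeffDual f φ‖ ^ 2 =
      (Fintype.card V : ℝ)⁻¹ * ∑ x, f x ^ 2 := by
  classical
  have hN : (Fintype.card V : ℂ) ≠ 0 := by exact_mod_cast Fintype.card_ne_zero
  have h1 : ∀ φ : Module.Dual (ZMod p) V, ((‖fourierCoeffDual f φ‖ ^ 2 : ℝ) : ℂ) =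
      ((Fintype.card V : ℂ) ^ 2)⁻¹ * ∑ x, ∑ y, (f x : ℂ) * f y * dualChar φ (x - y) := by
    intro φ
    rw [Complex.ofReal_pow, ← Complex.mul_conj', fourierCoeffDual, map_mul, map_sum, map_inv₀,
      Complex.conj_natCast, mul_mul_mul_comm, Finset.sum_mul_sum, ← mul_inv, ← sq]
    congr 1
    refine Finset.sum_congr rfl fun x _ => Finset.sum_congr rfl fun y _ => ?_
    rw [map_mul, Complex.conj_ofReal, conj_dualChar, sub_eq_add_neg, AddChar.map_add_eq_mul]
    ring
  rw [← Complex.ofReal_inj, Complex.ofReal_sum]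
  simp_rw [h1]
  rw [← Finset.mul_sum, Finset.sum_comm]
  simp_rw [Finset.sum_comm (s := (Finset.univ : Finset (Module.Dual (ZMod p) V))),
    ← Finset.mul_sum, sum_dualChar, sub_eq_zero]
  simp only [mul_ite, mul_zero, Finset.sum_ite_eq, Finset.mem_univ, if_true]
  push_cast
  rw [← Finset.sum_mul]
  simp_rw [← sq]
  field_simp

lemma sum_norm_sq_fourierCoeffDual_le_one {f : V → ℝ} (hf0 : ∀ x, 0 ≤ f x) (hf1 : ∀ x, f x ≤ 1) :
    ∑ φ : Module.Dual (ZMod p) V, ‖fourierCoeffDual f φ‖ ^ 2 ≤ 1 := by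
  have hN : (0 : ℝ) < Fintype.card V := by exact_mod_cast Fintype.card_pos
  rw [sum_norm_sq_fourierCoeffDual, inv_mul_le_iff₀ hN, mul_one, ← Finset.card_univ,
    ← nsmul_one, ← Finset.sum_const]
  exact Finset.sum_le_sum fun x _ => pow_le_one₀ (hf0 x) (hf1 x)

lemma lambda3_eq_sum_fourierCoeffDual (f : V → ℝ) :
    (Lambda3 f : ℂ) = ∑ φ : Module.Dual (ZMod p) V,
      fourierCoeffDual f φ ^ 2 * fourierCoeffDual f ((-2 : ZMod p) • φ) := by
  classical
  have hN : (Fintype.card V : ℂ) ≠ 0 := by exact_mod_cast Fintype.card_ne_zero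
  have h1 : ∀ φ : Module.Dual (ZMod p) V,
      fourierCoeffDual f φ ^ 2 * fourierCoeffDual f ((-2 : ZMod p) • φ) =
      ((Fintype.card V : ℂ) ^ 3)⁻¹ * ∑ x, ∑ y, ∑ z, (f x : ℂ) * f y * f z *
        dualChar φ (z - (2 • y - x)) := by
    intro φ
    have e : fourierCoeffDual f φ ^ 2 * fourierCoeffDual f ((-2 : ZMod p) • φ) =
      ((Fintype.card V : ℂ) ^ 3)⁻¹ * ((∑ x, (f x : ℂ) * dualChar φ x) *
        ((∑ y, (f y : ℂ) * dualChar ((-2 : ZMod p) • φ) y) *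
          ∑ z, (f z : ℂ) * dualChar φ z)) := by
      simp only [fourierCoeffDual]
      field_simp
    rw [e]
    congr 1
    rw [Finset.sum_mul_sum, Finset.sum_mul_sum]
    refine Finset.sum_congr rfl fun x _ => ?_
    refine Finset.sum_congr rfl fun y _ => ?_
    rw [Finset.mul_sum]
    refine Finset.sum_congr rfl fun z _ => ?_
    have e2 : z - (2 • y - x) = x + (-2 : ZMod p) • y + z := by
      rw [neg_smul, two_smul (ZMod p), two_nsmul]; abel
    rw [e2, dualChar_smul, AddChar.map_add_eq_mul, AddChar.map_add_eq_mul]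
    ring
  have h2 : ∀ x y : V, ∑ z, ∑ φ : Module.Dual (ZMod p) V, (f x : ℂ) * f y * f z *
      dualChar φ (z - (2 • y - x)) = Fintype.card V * (f x * f y * f (2 • y - x)) := by
    intro x y
    simp_rw [← Finset.mul_sum, sum_dualChar, sub_eq_zero]
    simp only [mul_ite, mul_zero, Finset.sum_ite_eq', Finset.mem_univ, if_true]
    ring
  simp_rw [h1]
  rw [← Finset.mul_sum, Finset.sum_comm]
  simp_rw [Finset.sum_comm (s := (Finset.univ : Finset (Module.Dual (ZMod p) V))), h2,
    ← Finset.mul_sum]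
  have h3 : ∀ x : V, ∑ y, (f x : ℂ) * f y * f (2 • y - x) =
      ∑ d, (f x : ℂ) * f (x + d) * f (x + 2 • d) := by
    intro x
    rw [← Equiv.sum_comp (Equiv.addLeft x)]
    refine Finset.sum_congr rfl fun d _ => ?_
    simp only [Equiv.coe_addLeft]
    rw [show 2 • (x + d) - x = x + 2 • d by rw [two_nsmul, two_nsmul]; abel]
  simp_rw [h3]
  unfold Lambda3
  push_cast
  field_simp

variable (W : Submodule (ZMod p) V) (f : V → ℝ)

lemma condAvg_add {w : V} (hw : w ∈ W) (x : V) : condAvg W f (x + w) = condAvg W f x := by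
  classical
  symm
  rw [condAvg_eq_sum, condAvg_eq_sum, ← Equiv.sum_comp (Equiv.addLeft (⟨w, hw⟩ : W))]
  refine congrArg _ (Finset.sum_congr rfl fun v _ => ?_)
  simp only [Equiv.coe_addLeft, Submodule.coe_add, add_assoc]

lemma condAvg_nonneg (hf : ∀ x, 0 ≤ f x) (x : V) : 0 ≤ condAvg W f x := by
  classical
  rw [condAvg_eq_sum]
  exact mul_nonneg (by positivity) (Finset.sum_nonneg fun w _ => hf _)

lemma condAvg_le_one (hf : ∀ x, f x ≤ 1) (x : V) : condAvg W f x ≤ 1 := by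
  classical
  have hN : (0 : ℝ) < Fintype.card W := by exact_mod_cast Fintype.card_pos
  rw [condAvg_eq_sum, inv_mul_le_iff₀ hN, mul_one, ← Finset.card_univ, ← nsmul_one,
    ← Finset.sum_const]
  exact Finset.sum_le_sum fun w _ => hf _

/-- Translation by `W` can be moved onto the invariant weight. The target `E` allows both real
weights and complex characters. -/
lemma sum_condAvg_smul {E : Type*} [AddCommGroup E] [Module ℝ E] (φ : V → E)
    (hφ : ∀ w ∈ W, ∀ x, φ (x + w) = φ x) : ∑ x, condAvg W f x • φ x = ∑ x, f x • φ x := by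
  classical
  have hN : (Fintype.card W : ℝ) ≠ 0 := by exact_mod_cast Fintype.card_ne_zero
  have h1 : ∀ w : W, ∑ x, f (x + w) • φ x = ∑ x, f x • φ x := by
    intro w
    rw [← Equiv.sum_comp (Equiv.addRight (w : V)) fun x => f x • φ x]
    exact Finset.sum_congr rfl fun x _ => by simp [hφ w w.2]
  simp_rw [condAvg_eq_sum, mul_smul, ← Finset.smul_sum, Finset.sum_smul]
  rw [Finset.sum_comm]
  simp_rw [h1]
  rw [Finset.sum_const, Finset.card_univ, ← Nat.cast_smul_eq_nsmul ℝ, smul_smul,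
    inv_mul_cancel₀ hN, one_smul]

lemma sum_condAvg : ∑ x, condAvg W f x = ∑ x, f x := by
  simpa using sum_condAvg_smul W f (fun _ => (1 : ℝ)) fun _ _ _ => rfl

lemma fourierCoeffDual_condAvg_of_mem {φ : Module.Dual (ZMod p) V} (hφ : ∀ w ∈ W, φ w = 0) :
    fourierCoeffDual (condAvg W f) φ = fourierCoeffDual f φ := by
  have h := sum_condAvg_smul W f (fun x => dualChar φ x) fun w hw x => by
    simp [dualChar_apply, hφ w hw]
  simp only [Complex.real_smul] at h
  rw [fourierCoeffDual, h, fourierCoeffDual]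

lemma fourierCoeffDual_condAvg_of_notMem {φ : Module.Dual (ZMod p) V} {w : V} (hw : w ∈ W)
    (hφ : φ w ≠ 0) : fourierCoeffDual (condAvg W f) φ = 0 := by
  have h : ∑ x, (condAvg W f x : ℂ) * dualChar φ x =
      dualChar φ w * ∑ x, (condAvg W f x : ℂ) * dualChar φ x := by
    conv_lhs => rw [← Equiv.sum_comp (Equiv.addRight w)]
    rw [Finset.mul_sum]
    refine Finset.sum_congr rfl fun x _ => ?_
    simp only [Equiv.coe_addRight]
    rw [condAvg_add W f hw, AddChar.map_add_eq_mul]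
    ring
  have h1 : dualChar φ w ≠ 1 := fun h => hφ (dualChar_eq_one_iff.1 h)
  have h0 : (dualChar φ w - 1) * ∑ x, (condAvg W f x : ℂ) * dualChar φ x = 0 := by
    linear_combination -h
  rw [fourierCoeffDual, (mul_eq_zero.1 h0).resolve_left (sub_ne_zero.2 h1), mul_zero]

/-- If all Fourier coefficients of `f` outside the annihilator of `W` are small, averaging over
the cosets of `W` hardly changes the number of progressions. -/
theorem abs_lambda3_condAvg_sub_le (hp : p ≠ 2) (hf0 : ∀ x, 0 ≤ f x) (hf1 : ∀ x, f x ≤ 1) {ε : ℝ}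
    (hε : 0 ≤ ε) (hW : ∀ φ : Module.Dual (ZMod p) V, (∃ w ∈ W, φ w ≠ 0) →
      ‖fourierCoeffDual f φ‖ ≤ ε) : |Lambda3 (condAvg W f) - Lambda3 f| ≤ ε := by
  have h2 : (-2 : ZMod p) ≠ 0 := neg_ne_zero.2 (ZMod.two_ne_zero_of_ne_two hp)
  have hparseval := sum_norm_sq_fourierCoeffDual_le_one (p := p) hf0 hf1
  rw [← Real.norm_eq_abs, ← Complex.norm_real, Complex.ofReal_sub,
    lambda3_eq_sum_fourierCoeffDual (p := p), lambda3_eq_sum_fourierCoeffDual (p := p),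
    ← Finset.sum_sub_distrib]
  refine (norm_sum_le _ _).trans ?_
  calc _ ≤ ∑ φ : Module.Dual (ZMod p) V, ε * ‖fourierCoeffDual f φ‖ ^ 2 := ?_
    _ ≤ ε := by rw [← Finset.mul_sum]; exact mul_le_of_le_one_right hε hparseval
  refine Finset.sum_le_sum fun φ _ => ?_
  by_cases hφ : ∀ w ∈ W, φ w = 0
  · rw [fourierCoeffDual_condAvg_of_mem W f hφ,
      fourierCoeffDual_condAvg_of_mem W f fun w hw => by simp [hφ w hw], sub_self, norm_zero]
    positivity
  · push Not at hφ
    obtain ⟨w, hw, hφw⟩ := hφ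
    rw [fourierCoeffDual_condAvg_of_notMem W f hw hφw, zero_pow two_ne_zero, zero_mul, zero_sub,
      norm_neg, norm_mul, norm_pow, mul_comm]
    -- As `-2` is invertible, `-2 • φ` is also non-trivial on `W`: its coefficient is at most `ε`,
    -- and the remaining squares go to Parseval.
    refine mul_le_mul_of_nonneg_right (hW _ ⟨w, hw, ?_⟩) (by positivity)
    simpa using ⟨ZMod.two_ne_zero_of_ne_two hp, hφw⟩

/-- A subspace of bounded codimension annihilated by the large spectrum of `f`. -/
theorem exists_submodule_fourierCoeffDual_le (hf0 : ∀ x, 0 ≤ f x) (hf1 : ∀ x, f x ≤ 1) {ε : ℝ}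
    (hε : 0 < ε) : ∃ W : Submodule (ZMod p) V,
      (Module.finrank (ZMod p) V : ℝ) ≤ Module.finrank (ZMod p) W + (ε ^ 2)⁻¹ ∧
      ∀ φ : Module.Dual (ZMod p) V, (∃ w ∈ W, φ w ≠ 0) → ‖fourierCoeffDual f φ‖ ≤ ε := by
  classical
  have hparseval := sum_norm_sq_fourierCoeffDual_le_one (p := p) hf0 hf1
  set Γ : Finset (Module.Dual (ZMod p) V) :=
    Finset.univ.filter fun φ => ε < ‖fourierCoeffDual f φ‖ with hΓ
  have hcard : (Γ.card : ℝ) ≤ (ε ^ 2)⁻¹ := by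
    have : (Γ.card : ℝ) * ε ^ 2 ≤ 1 := by
      rw [← nsmul_eq_mul, ← Finset.sum_const]
      refine le_trans (Finset.sum_le_sum (g := fun φ => ‖fourierCoeffDual f φ‖ ^ 2) ?_)
        ((Finset.sum_le_univ_sum_of_nonneg fun φ => by positivity).trans hparseval)
      intro φ hφ
      have := (Finset.mem_filter.1 hφ).2
      gcongr
    rw [← one_div, le_div_iff₀ (by positivity)]
    exact this
  refine ⟨(Submodule.span (ZMod p) (Γ : Set (Module.Dual (ZMod p) V))).dualCoannihilator, ?_, ?_⟩
  · have h1 := Subspace.finrank_add_finrank_dualCoannihilator_eq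
      (Submodule.span (ZMod p) (Γ : Set (Module.Dual (ZMod p) V)))
    have h2 := finrank_span_finset_le_card (R := ZMod p) Γ
    have h3 : (Module.finrank (ZMod p) (Submodule.span (ZMod p) (Γ : Set (Module.Dual (ZMod p) V)))
      : ℝ) ≤ Γ.card := by exact_mod_cast h2
    rw [← h1]
    push_cast
    linarith
  · rintro φ ⟨w, hw, hφw⟩
    by_contra! hlt
    rw [Submodule.mem_dualCoannihilator] at hw
    exact hφw (hw φ (Submodule.subset_span (by simp [hΓ, hlt])))

end Fourier

/-! ### Rounding functions to sets. -/

section Rounding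

variable {G : Type*} [AddCommGroup G] [Fintype G] [DecidableEq G]

/-- The number of non-trivial three-term progressions, weighted by `f`. -/
def properCount (f : G → ℝ) : ℝ :=
  ∑ m : G, ∑ d : G, if d = 0 then 0 else f m * f (m + d) * f (m + 2 • d)

/-- Trivial progressions contribute a convex cube that would spoil the concavity used in rounding,
so they are split off. -/
lemma sq_card_mul_lambda3_eq_properCount_add (f : G → ℝ) :
    (Fintype.card G : ℝ) ^ 2 * Lambda3 f = properCount f + ∑ x, f x ^ 3 := by
  rw [sq_card_mul_lambda3, properCount, ← Finset.sum_add_distrib]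
  refine Finset.sum_congr rfl fun m _ => ?_
  have : f m ^ 3 = ∑ d : G, if d = 0 then f m ^ 3 else 0 := by simp
  rw [this, ← Finset.sum_add_distrib]
  refine Finset.sum_congr rfl fun d _ => ?_
  split_ifs with h
  · simp [h]; ring
  · simp

/-- The weighted number of non-trivial progressions is concave in the direction `e x - e y`. -/
lemma exists_slope_properCount (h2 : Function.Injective fun x : G => 2 • x) {f : G → ℝ}
    (hf : ∀ x, 0 ≤ f x) (x y : G) :
    ∃ L : ℝ, ∀ t : ℝ, properCount (fun z => f z +
      t * ((if z = x then 1 else 0) - (if z = y then 1 else 0))) ≤ properCount f + t * L := by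
  set u : G → ℝ := fun z => (if z = x then 1 else 0) - (if z = y then 1 else 0) with hu
  have hu2 : ∀ a b, a ≠ b → u a * u b ≤ 0 := by
    intro a b hab
    simp only [hu]
    split_ifs <;> simp_all
  -- The direction `u` lives on two points with opposite signs: the cubic term in `t` vanishes and,
  -- by `hu2`, the quadratic term is non-positive.
  have hu3 : ∀ a b c, a ≠ b → a ≠ c → b ≠ c → u a * u b * u c = 0 := by
    intro a b c hab hac hbc
    simp only [hu]
    split_ifs <;> simp_all
  refine ⟨∑ m : G, ∑ d : G, if d = 0 then 0 else u m * f (m + d) * f (m + 2 • d) +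
    f m * u (m + d) * f (m + 2 • d) + f m * f (m + d) * u (m + 2 • d), fun t => ?_⟩
  have hfold : ∀ z, (if z = x then (1 : ℝ) else 0) - (if z = y then 1 else 0) = u z := fun _ => rfl
  simp_rw [hfold, properCount, Finset.mul_sum, ← Finset.sum_add_distrib]
  clear_value u
  refine Finset.sum_le_sum fun m _ => Finset.sum_le_sum fun d _ => ?_
  split_ifs with hd
  · simp
  have h2d : 2 • d ≠ 0 := fun h => hd (h2 (by simpa using h))
  have hab : m ≠ m + d := by simpa using hd
  have hac : m ≠ m + 2 • d := by simpa using h2d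
  have hbc : m + d ≠ m + 2 • d := by simpa [two_nsmul] using hd
  have e3 := hu3 _ _ _ hab hac hbc
  have e1 := mul_nonpos_of_nonpos_of_nonneg (hu2 _ _ hab) (hf (m + 2 • d))
  have e2 := mul_nonpos_of_nonpos_of_nonneg (hu2 _ _ hac) (hf (m + d))
  have e4 := mul_nonpos_of_nonpos_of_nonneg (hu2 _ _ hbc) (hf m)
  have e5 := mul_nonpos_of_nonneg_of_nonpos (sq_nonneg t) (add_nonpos (add_nonpos e1 e2) e4)
  linear_combination e5 + t ^ 3 * e3

/-- Two fractional values can be moved until one of them is integral. -/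
lemma exists_fewer_fractional (h2 : Function.Injective fun x : G => 2 • x) {f : G → ℝ}
    (hf0 : ∀ x, 0 ≤ f x) (hf1 : ∀ x, f x ≤ 1) {x y : G} (hxy : x ≠ y)
    (hx : 0 < f x ∧ f x < 1) (hy : 0 < f y ∧ f y < 1) :
    ∃ g : G → ℝ, (∀ z, 0 ≤ g z) ∧ (∀ z, g z ≤ 1) ∧ ∑ z, g z = ∑ z, f z ∧
      properCount g ≤ properCount f ∧
      (Finset.univ.filter fun z => 0 < g z ∧ g z < 1) ⊂
        Finset.univ.filter fun z => 0 < f z ∧ f z < 1 := by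
  obtain ⟨L, hL⟩ := exists_slope_properCount h2 hf0 x y
  wlog hLneg : L ≤ 0 generalizing x y L
  · refine this hxy.symm hy hx (-L) (fun t => ?_) (by linarith)
    convert! hL (-t) using 1
    · congr 1; funext z; ring
    · ring
  -- The longest admissible step: either `x` reaches 1 or `y` reaches 0.
  set t := min (1 - f x) (f y) with ht
  have ht0 : 0 < t := lt_min (by linarith) hy.1
  have ht1 : t ≤ 1 - f x := min_le_left _ _
  have ht2 : t ≤ f y := min_le_right _ _
  set g : G → ℝ := fun z => f z + t * ((if z = x then 1 else 0) - (if z = y then 1 else 0)) with hg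
  have hgx : g x = f x + t := by simp [hg, hxy]
  have hgy : g y = f y - t := by simp [hg, hxy.symm]; ring
  have hgz : ∀ z, z ≠ x → z ≠ y → g z = f z := fun z h h' => by simp [hg, h, h']
  refine ⟨g, fun z => ?_, fun z => ?_, ?_, (hL t).trans (by nlinarith), ?_⟩
  · by_cases h : z = x
    · subst h; rw [hgx]; linarith
    by_cases h' : z = y
    · subst h'; rw [hgy]; linarith
    rw [hgz z h h']; exact hf0 z
  · by_cases h : z = x
    · subst h; rw [hgx]; linarith
    by_cases h' : z = y
    · subst h'; rw [hgy]; linarith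
    rw [hgz z h h']; exact hf1 z
  · simp only [hg, Finset.sum_add_distrib, ← Finset.mul_sum, Finset.sum_sub_distrib]
    simp
  · refine (Finset.ssubset_iff_of_subset fun z hz => ?_).2 ?_
    · rw [Finset.mem_filter] at hz ⊢
      by_cases h : z = x
      · subst h; simpa using hx
      by_cases h' : z = y
      · subst h'; simpa using hy
      rwa [hgz z h h'] at hz
    · rcases min_choice (1 - f x) (f y) with h | h
      · refine ⟨x, by simpa using hx, ?_⟩
        rw [← ht] at h
        simp only [Finset.mem_filter, Finset.mem_univ, true_and, hgx, h]
        rintro ⟨-, h'⟩; linarith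
      · refine ⟨y, by simpa using hy, ?_⟩
        rw [← ht] at h
        simp only [Finset.mem_filter, Finset.mem_univ, true_and, hgy, h]
        rintro ⟨h', -⟩; linarith

/-- Rounding a `[0,1]`-valued function of integral sum to a set of the same size, without
increasing the number of non-trivial progressions. -/
theorem exists_finset_properCount_le (h2 : Function.Injective fun x : G => 2 • x) (k : ℕ)
    (f : G → ℝ) (hf0 : ∀ x, 0 ≤ f x) (hf1 : ∀ x, f x ≤ 1) (hfk : ∑ x, f x = k) :
    ∃ S : Finset G, S.card = k ∧
      properCount (fun x => if x ∈ S then 1 else 0) ≤ properCount f := by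
  induction hs : (Finset.univ.filter fun z => 0 < f z ∧ f z < 1) using Finset.strongInduction
    generalizing f with
  | H s ih =>
  have hint : ∀ z, z ∉ s → f z = if f z = 1 then 1 else 0 := by
    intro z hz
    rw [← hs, Finset.mem_filter] at hz
    split_ifs with h
    · exact h
    · by_contra h0
      exact hz ⟨Finset.mem_univ _, lt_of_le_of_ne (hf0 z) (Ne.symm h0),
        lt_of_le_of_ne (hf1 z) h⟩
  rcases s.eq_empty_or_nonempty with hempty | ⟨x, hx⟩
  · subst hempty
    have hf : f = fun z => if z ∈ Finset.univ.filter (fun z => f z = 1) then 1 else 0 := by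
      funext z
      simpa using hint z (by simp)
    refine ⟨Finset.univ.filter fun z => f z = 1, ?_, by rw [← hf]⟩
    rw [hf] at hfk
    simpa using hfk
  have hfx : 0 < f x ∧ f x < 1 := by simpa [← hs] using hx
  by_cases hy : ∃ y ∈ s, y ≠ x
  · obtain ⟨y, hys, hyx⟩ := hy
    have hfy : 0 < f y ∧ f y < 1 := by simpa [← hs] using hys
    obtain ⟨g, hg0, hg1, hgsum, hgle, hgs⟩ := exists_fewer_fractional h2 hf0 hf1 hyx.symm hfx hfy
    obtain ⟨S, hS, hSle⟩ := ih _ (hs ▸ hgs) g hg0 hg1 (hgsum.trans hfk) rfl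
    exact ⟨S, hS, hSle.trans hgle⟩
  -- A single fractional value would make the sum non-integral.
  · push Not at hy
    exfalso
    have h1 : f x + ∑ z ∈ Finset.univ.erase x, f z = k := by
      rw [← hfk, Finset.add_sum_erase _ _ (Finset.mem_univ x)]
    have h2 : ∑ z ∈ Finset.univ.erase x, f z =
        ((Finset.univ.erase x).filter fun z => f z = 1).card := by
      rw [← Finset.sum_boole]
      exact Finset.sum_congr rfl fun z hz =>
        hint z fun hzs => (Finset.ne_of_mem_erase hz) (hy z hzs)
    rw [h2] at h1
    have h3 : ((((Finset.univ.erase x).filter fun z => f z = 1).card : ℕ) : ℝ) < k := by linarith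
    have h4 : (k : ℝ) < (((Finset.univ.erase x).filter fun z => f z = 1).card + 1 : ℕ) := by
      push_cast; linarith
    rw [Nat.cast_lt] at h3 h4
    omega

lemma exists_finset_lambda3_le (h2 : Function.Injective fun x : G => 2 • x) (k : ℕ)
    (f : G → ℝ) (hf0 : ∀ x, 0 ≤ f x) (hf1 : ∀ x, f x ≤ 1) (hfk : ∑ x, f x = k) :
    ∃ S : Finset G, S.card = k ∧
      Lambda3 (fun x => if x ∈ S then 1 else 0) ≤ Lambda3 f + (Fintype.card G : ℝ)⁻¹ := by
  obtain ⟨S, hS, hle⟩ := exists_finset_properCount_le h2 k f hf0 hf1 hfk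
  refine ⟨S, hS, ?_⟩
  have hN : (0 : ℝ) < Fintype.card G := by exact_mod_cast Fintype.card_pos
  have e1 := sq_card_mul_lambda3_eq_properCount_add fun x => if x ∈ S then (1 : ℝ) else 0
  have e2 := sq_card_mul_lambda3_eq_properCount_add f
  have e3 : ∑ x, (if x ∈ S then (1 : ℝ) else 0) ^ 3 ≤ Fintype.card G := by
    rw [← Finset.card_univ, ← nsmul_one, ← Finset.sum_const]
    refine Finset.sum_le_sum fun x _ => ?_
    split_ifs <;> norm_num
  have e4 : 0 ≤ ∑ x, f x ^ 3 := Finset.sum_nonneg fun x _ => pow_nonneg (hf0 x) 3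
  refine le_of_mul_le_mul_left ?_ (pow_pos hN 2)
  rw [mul_add, e1, e2, pow_two, mul_assoc, mul_inv_cancel₀ hN.ne', mul_one]
  linarith

end Rounding

lemma sum_indicator_one {V : Type*} [Fintype V] (S : Set V) :
    ∑ x, S.indicator (fun _ => (1 : ℝ)) x = S.ncard := by
  classical
  rw [Set.ncard_eq_toFinset_card', ← Set.filter_mem_univ_eq_toFinset, ← Finset.sum_boole]
  rfl

/-! ### Structure of minimizers. -/

section Structure

variable {p : ℕ} [Fact p.Prime] {V : Type*} [AddCommGroup V] [Module (ZMod p) V] [Fintype V]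

lemma exists_transversal_add_eq (W : Submodule (ZMod p) V) (B : Set V)
    (hB : ∀ w ∈ W, ∀ x, x + w ∈ B ↔ x ∈ B) : ∃ A : Set V, A + (W : Set V) = B ∧
      A.ncard ≤ p ^ (Module.finrank (ZMod p) V - Module.finrank (ZMod p) W) := by
  refine ⟨{x ∈ B | (Submodule.Quotient.mk x : V ⧸ W).out = x}, ?_, ?_⟩
  · ext x
    rw [Set.mem_add]
    constructor
    · rintro ⟨a, ⟨ha, -⟩, w, hw, rfl⟩
      exact (hB w hw a).2 ha
    · intro hx
      set a := (Submodule.Quotient.mk x : V ⧸ W).out with ha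
      have hmk : (Submodule.Quotient.mk a : V ⧸ W) = Submodule.Quotient.mk x := Quotient.out_eq _
      have hw : x - a ∈ W := (Submodule.Quotient.eq W).1 hmk.symm
      refine ⟨a, ⟨(hB _ hw a).1 (by simpa using hx), by rw [hmk]⟩, x - a, hw, by abel⟩
  · have h1 : Nat.card (V ⧸ W) =
        p ^ (Module.finrank (ZMod p) V - Module.finrank (ZMod p) W) := by
      rw [Module.natCard_eq_pow_finrank (K := ZMod p), Nat.card_zmod,
        Submodule.finrank_quotient]
    rw [← h1, ← Set.ncard_univ]
    refine Set.ncard_le_ncard_of_injOn (fun x => (Submodule.Quotient.mk x : V ⧸ W))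
      (fun _ _ => Set.mem_univ _) ?_
    rintro x ⟨-, hx⟩ y ⟨-, hy⟩ hxy
    rw [← hx, ← hy]
    exact congrArg _ hxy

/-- If the averages of `S` over the cosets of `W` are close to `0` or `1`, then `S` is close to a
union of cosets of `W`. -/
lemma exists_union_cosets_approx {α : ℝ} (hα0 : 0 < α) (hα1 : α ≤ 1) (W : Submodule (ZMod p) V)
    (S : Set V) (hS : α * Fintype.card V ≤ S.ncard) : ∃ A : Set V, A.Nonempty ∧
      A.ncard ≤ p ^ (Module.finrank (ZMod p) V - Module.finrank (ZMod p) W) ∧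
      ((S ∆ (A + (W : Set V))).ncard : ℝ) ≤ 2 / α * ∑ x,
        condAvg W (S.indicator fun _ => 1) x * (1 - condAvg W (S.indicator fun _ => 1) x) := by
  classical
  set f : V → ℝ := S.indicator fun _ => 1 with hf
  set g := condAvg W f with hg
  have hf0 : ∀ x, 0 ≤ f x := fun x => Set.indicator_nonneg (fun _ _ => zero_le_one) x
  have hf1 : ∀ x, f x ≤ 1 := fun x => Set.indicator_le_self' (fun _ _ => zero_le_one) x
  have hg0 : ∀ x, 0 ≤ g x := condAvg_nonneg W f hf0
  have hg1 : ∀ x, g x ≤ 1 := condAvg_le_one W f hf1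
  have hN : (0 : ℝ) < Fintype.card V := by exact_mod_cast Fintype.card_pos
  have hgW : ∀ w ∈ W, ∀ x, g (x + w) = g x := fun w hw x => condAvg_add W f hw x
  have hsumg : ∑ x, g x = S.ncard := by
    rw [hg, sum_condAvg, sum_indicator_one]
  -- The threshold `α/2` is below the mean of `g`, so `B` is non-empty; being at most `1/2`, it also
  -- bounds the pointwise error by `(2/α) g (1 - g)` on both sides.
  set B : Set V := {x | α / 2 ≤ g x} with hB
  obtain ⟨A, hAW, hA⟩ := exists_transversal_add_eq W B fun w hw x => by
    simp only [hB, Set.mem_ofPred_eq, hgW w hw x]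
  have hBne : B.Nonempty := by
    by_contra hne
    rw [Set.not_nonempty_iff_eq_empty, Set.eq_empty_iff_forall_notMem] at hne
    have : ∑ x, g x ≤ ∑ _x : V, α / 2 := Finset.sum_le_sum fun x _ => (not_le.1 (hne x)).le
    rw [hsumg, Finset.sum_const, Finset.card_univ, nsmul_eq_mul] at this
    nlinarith
  refine ⟨A, Set.Nonempty.of_add_left (hAW ▸ hBne), hA, ?_⟩
  set b : V → ℝ := B.indicator fun _ => 1 with hb
  have hbW : ∀ w ∈ W, ∀ x, b (x + w) = b x := fun w hw x => by
    simp only [hb, hB, Set.indicator_apply, Set.mem_ofPred_eq, hgW w hw x]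
  -- The size of `S ∆ B` is affine in `f` with a `W`-invariant weight, so `f` may be replaced by
  -- `g`.
  have hfb : ∑ x, g x * (1 - 2 * b x) = ∑ x, f x * (1 - 2 * b x) :=
    sum_condAvg_smul W f (fun x => 1 - 2 * b x) fun w hw x => by rw [hbW w hw]
  have hdiff : ∀ x, (S ∆ B).indicator (fun _ => (1 : ℝ)) x = f x * (1 - 2 * b x) + b x := by
    intro x
    by_cases h1 : x ∈ S <;> by_cases h2 : x ∈ B <;>
      (simp [hf, hb, Set.mem_symmDiff, h1, h2]; try norm_num)
  rw [hAW, ← sum_indicator_one, Finset.sum_congr rfl fun x _ => hdiff x, Finset.sum_add_distrib,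
    ← hfb, ← Finset.sum_add_distrib, Finset.mul_sum]
  refine Finset.sum_le_sum fun x _ => ?_
  rw [div_mul_eq_mul_div, le_div_iff₀ hα0]
  by_cases h : x ∈ B
  · have h' : α / 2 ≤ g x := h
    simp only [hb, Set.indicator_of_mem h]
    nlinarith [hg1 x]
  · have h' : g x < α / 2 := not_le.1 h
    simp only [hb, Set.indicator_of_notMem h]
    nlinarith [hg0 x]

/-- If a minimizer `S` is Fourier-uniform relative to `W`, then perturbing its average along a
functional non-trivial on `W` cannot pay off. -/
lemma lambda3_condAvg_mul_le_of_minimal (hp : p ≠ 2) {W : Submodule (ZMod p) V} (hW : W ≠ ⊥)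
    {S : Set V} (hmin : ∀ T : Set V, S.ncard ≤ T.ncard → Lambda3Set S ≤ Lambda3Set T) {ε : ℝ}
    (hε : |Lambda3 (condAvg W (S.indicator fun _ => 1)) - Lambda3Set S| ≤ ε) :
    Lambda3 (fun x => condAvg W (S.indicator fun _ => 1) x *
      (1 - condAvg W (S.indicator fun _ => 1) x)) ≤
        2 * p ^ 2 * (ε + (Fintype.card V : ℝ)⁻¹) := by
  classical
  set f : V → ℝ := S.indicator fun _ => 1 with hf
  set g := condAvg W f with hg
  have hf0 : ∀ x, 0 ≤ f x := fun x => Set.indicator_nonneg (fun _ _ => zero_le_one) x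
  have hf1 : ∀ x, f x ≤ 1 := fun x => Set.indicator_le_self' (fun _ _ => zero_le_one) x
  have hg0 : ∀ x, 0 ≤ g x := condAvg_nonneg W f hf0
  have hg1 : ∀ x, g x ≤ 1 := condAvg_le_one W f hf1
  have hgW : ∀ w ∈ W, ∀ x, g (x + w) = g x := fun w hw x => condAvg_add W f hw x
  set c : V → ℝ := fun x => g x * (1 - g x) with hc
  have hc0 : ∀ x, 0 ≤ c x := fun x => mul_nonneg (hg0 x) (sub_nonneg.2 (hg1 x))
  obtain ⟨w₀, hw₀, hw₀0⟩ := W.exists_mem_ne_zero_of_ne_bot hW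
  obtain ⟨ℓ, hℓ⟩ := Module.Projective.exists_dual_eq_one (ZMod p) hw₀0
  have hpR : (2 : ℝ) ≤ p := by exact_mod_cast (Fact.out (p := p.Prime)).two_le
  have h2 : Function.Injective fun x : V => 2 • x := two_nsmul_injective_of_ne_two hp
  set h : V → ℝ := fun x => g x + c x * dip p (ℓ x) with hh
  have hΛ : Lambda3 h = Lambda3 g - ((p : ℝ) ^ 2)⁻¹ * (1 - (p : ℝ)⁻¹) * Lambda3 c :=
    lambda3_add_mul_dip hp g c ℓ w₀ hℓ (fun x s => hgW _ (W.smul_mem s hw₀) x)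
      fun x s => by simp only [hc, hgW _ (W.smul_mem s hw₀) x]
  -- The amplitude `g (1 - g)` keeps `h` between `g²` and `1 - (1 - g)²`.
  have hh0 : ∀ x, 0 ≤ h x := by
    intro x
    have := abs_le.1 (abs_dip_le_one (p := p) (ℓ x))
    have e := mul_le_mul_of_nonneg_left this.1 (hc0 x)
    have : 0 ≤ g x * g x := mul_self_nonneg _
    simp only [hh]
    simp only [hc] at e ⊢
    linarith
  have hh1 : ∀ x, h x ≤ 1 := by
    intro x
    have := abs_le.1 (abs_dip_le_one (p := p) (ℓ x))
    have e := mul_le_mul_of_nonneg_left this.2 (hc0 x)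
    have : 0 ≤ (1 - g x) * (1 - g x) := mul_self_nonneg _
    simp only [hh]
    simp only [hc] at e ⊢
    linarith
  have hsum : ∑ x, h x = S.ncard := by
    have h0 := sum_mul_dip c ℓ w₀ hℓ fun x s => by simp only [hc, hgW _ (W.smul_mem s hw₀) x]
    rw [hh, Finset.sum_add_distrib, h0, add_zero, hg, sum_condAvg, sum_indicator_one]
  obtain ⟨T, hT, hTle⟩ := exists_finset_lambda3_le h2 _ h hh0 hh1 hsum
  have hST := hmin T (by rw [Set.ncard_coe_finset, hT])
  have hTΛ : Lambda3Set (T : Set V) = Lambda3 fun x => if x ∈ T then 1 else 0 := by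
    unfold Lambda3Set
    congr 1
    funext x
    simp [Set.indicator_apply]
  have hcΛ : 0 ≤ Lambda3 c := by
    unfold Lambda3
    exact mul_nonneg (by positivity) (Finset.sum_nonneg fun m _ => Finset.sum_nonneg fun d _ =>
      mul_nonneg (mul_nonneg (hc0 _) (hc0 _)) (hc0 _))
  have hinv : (p : ℝ)⁻¹ ≤ 1 / 2 := by rw [inv_le_comm₀ (by linarith) (by norm_num)]; linarith
  have hmain : ((p : ℝ) ^ 2)⁻¹ * (1 - (p : ℝ)⁻¹) * Lambda3 c ≤ ε + (Fintype.card V : ℝ)⁻¹ := by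
    have := (abs_le.1 hε).2
    rw [hTΛ] at hST
    linarith
  have hlow : ((p : ℝ) ^ 2)⁻¹ * (1 / 2) * Lambda3 c ≤ ε + (Fintype.card V : ℝ)⁻¹ := by
    refine le_trans ?_ hmain
    gcongr
    linarith
  have hp2pos : (0 : ℝ) < p ^ 2 := by positivity
  calc Lambda3 c = 2 * p ^ 2 * (((p : ℝ) ^ 2)⁻¹ * (1 / 2) * Lambda3 c) := by field_simp
    _ ≤ _ := by gcongr

end Structure

/-! ### Fixed precision, then the diagonal argument. -/

/-- The qualitative form of the main theorem: up to an error `η`, minimizers are unions of cosets of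
a subspace of bounded codimension. -/
theorem exists_bounded_codimension_approx (p : ℕ) [Fact p.Prime] (hp : p ≠ 2) {α : ℝ}
    (hα0 : 0 < α) (hα1 : α ≤ 1) {η : ℝ} (hη : 0 < η) : ∃ K : ℕ, ∀ (V : Type) [AddCommGroup V]
      [Module (ZMod p) V] [Fintype V] (S : Set V), α * Fintype.card V ≤ S.ncard →
        (∀ T : Set V, α * Fintype.card V ≤ T.ncard → Lambda3Set S ≤ Lambda3Set T) →
        ∃ (W : Submodule (ZMod p) V) (A : Set V),
          Module.finrank (ZMod p) V ≤ Module.finrank (ZMod p) W + K ∧ A.Nonempty ∧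
          A.ncard ≤ p ^ K ∧
          ((S ∆ (A + (W : Set V))).ncard : ℝ) ≤ η * Fintype.card V := by
  -- The density `ηα/2` offsets the factor `2/α` in `exists_union_cosets_approx`.
  obtain ⟨κ, hκ, hvar⟩ := exists_pos_le_lambda3 (η := η * α / 2) (by positivity)
  have hp0 : (0 : ℝ) < p := by exact_mod_cast (Fact.out (p := p.Prime)).pos
  -- Chosen so that `2p²(ε + ε) = κ/2 < κ`.
  set ε : ℝ := κ / (8 * p ^ 2) with hε
  have hε0 : 0 < ε := by positivity
  -- The bound `ε⁻²` controls the codimension; `ε⁻¹` gives `1/|V| < ε` once the dimension exceeds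
  -- `K`. In smaller dimension, `W = ⊥` and `A = S` suffice.
  obtain ⟨K, hK⟩ := exists_nat_gt (max (ε ^ 2)⁻¹ ε⁻¹)
  refine ⟨K, fun V _ _ _ S hS hmin => ?_⟩
  have hN : (0 : ℝ) < Fintype.card V := by exact_mod_cast Fintype.card_pos
  have hSne : S.Nonempty := by
    by_contra h
    rw [Set.not_nonempty_iff_eq_empty] at h
    rw [h, Set.ncard_empty, Nat.cast_zero] at hS
    nlinarith
  have hcard : Fintype.card V = p ^ Module.finrank (ZMod p) V := by
    rw [Module.card_eq_pow_finrank (K := ZMod p), ZMod.card]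
  rcases le_or_gt (Module.finrank (ZMod p) V) K with hsmall | hlarge
  · refine ⟨⊥, S, by omega, hSne, ?_, ?_⟩
    · refine (Set.ncard_le_card S).trans ?_
      rw [Nat.card_eq_fintype_card, hcard]
      exact Nat.pow_le_pow_right (Fact.out (p := p.Prime)).pos hsmall
    · rw [Submodule.bot_coe, Set.singleton_zero, add_zero, symmDiff_self, Set.bot_eq_empty,
        Set.ncard_empty, Nat.cast_zero]
      positivity
  have hf0 : ∀ x, 0 ≤ S.indicator (fun _ => (1 : ℝ)) x := fun x =>
    Set.indicator_nonneg (fun _ _ => zero_le_one) x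
  have hf1 : ∀ x, S.indicator (fun _ => (1 : ℝ)) x ≤ 1 := fun x =>
    Set.indicator_le_self' (fun _ _ => zero_le_one) x
  obtain ⟨W, hWdim, hWspec⟩ := exists_submodule_fourierCoeffDual_le (p := p)
    (S.indicator fun _ => 1) hf0 hf1 hε0
  have hWdim' : Module.finrank (ZMod p) V ≤ Module.finrank (ZMod p) W + K := by
    have : (Module.finrank (ZMod p) V : ℝ) ≤ Module.finrank (ZMod p) W + K := by
      linarith [(le_max_left _ _).trans hK.le]
    exact_mod_cast this
  have hWbot : W ≠ ⊥ := by
    rintro rfl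
    rw [finrank_bot] at hWdim'
    omega
  obtain ⟨A, hAne, hA, hSA⟩ := exists_union_cosets_approx hα0 hα1 W S hS
  refine ⟨W, A, hWdim', hAne, hA.trans (Nat.pow_le_pow_right (Fact.out (p := p.Prime)).pos
    (by omega)), hSA.trans ?_⟩
  by_contra! hbig
  have h2 : Function.Injective fun x : V => 2 • x := two_nsmul_injective_of_ne_two hp
  have hg0 := condAvg_nonneg W _ hf0
  have hg1 := condAvg_le_one W _ hf1
  have hlow := hvar V h2 (fun x => condAvg W (S.indicator fun _ => 1) x *
      (1 - condAvg W (S.indicator fun _ => 1) x))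
      (fun x => mul_nonneg (hg0 x) (sub_nonneg.2 (hg1 x)))
      (fun x => mul_le_one₀ (hg1 x) (sub_nonneg.2 (hg1 x)) (by linarith [hg0 x])) (by
        rw [div_mul_eq_mul_div, lt_div_iff₀ hα0] at hbig
        linarith)
  have hup := lambda3_condAvg_mul_le_of_minimal hp hWbot
    (fun T hT => hmin T (hS.trans (by exact_mod_cast hT)))
    (abs_lambda3_condAvg_sub_le W _ hp hf0 hf1 hε0.le hWspec)
  have hNinv : (Fintype.card V : ℝ)⁻¹ < ε := by
    rw [inv_lt_comm₀ hN hε0]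
    have h1 : (K : ℝ) < Fintype.card V := by
      rw [hcard]
      exact_mod_cast hlarge.trans (Nat.lt_pow_self (Fact.out (p := p.Prime)).one_lt)
    linarith [(le_max_right (ε ^ 2)⁻¹ ε⁻¹).trans hK.le]
  have : κ < 2 * p ^ 2 * (ε + ε) := (hlow.trans hup).trans_lt (by gcongr)
  rw [hε] at this
  field_simp at this
  linarith

/-- Diagonal choice: a parameter tending to infinity so slowly that a given function of it is
negligible. -/
lemma exists_tendsto_isLittleO_comp (K : ℕ → ℕ) : ∃ j : ℕ → ℕ, Tendsto j atTop atTop ∧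
    (fun n => (K (j n) : ℝ)) =o[atTop] fun n : ℕ => (n : ℝ) := by
  -- The square yields `K (j n) ≤ √n = o(n)`, valid once `K 0 ^ 2 ≤ n`, so that the default value 0
  -- also qualifies.
  set j : ℕ → ℕ := fun n => Nat.findGreatest (fun i => K i ^ 2 ≤ n) n with hj
  refine ⟨j, ?_, ?_⟩
  · rw [tendsto_atTop]
    intro J
    filter_upwards [eventually_ge_atTop (max J (K J ^ 2))] with n hn
    exact Nat.le_findGreatest ((le_max_left _ _).trans hn) ((le_max_right _ _).trans hn)
  · have hle : ∀ᶠ n : ℕ in atTop, K (j n) ^ 2 ≤ n := by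
      filter_upwards [eventually_ge_atTop (K 0 ^ 2)] with n hn
      exact Nat.findGreatest_spec (P := fun i => K i ^ 2 ≤ n) (Nat.zero_le n) hn
    rw [isLittleO_iff]
    intro c hc
    filter_upwards [hle, eventually_ge_atTop ⌈(c ^ 2)⁻¹⌉₊] with n hn hnc
    have h1 : (K (j n) : ℝ) ^ 2 ≤ n := by exact_mod_cast hn
    have h2 : (c ^ 2)⁻¹ ≤ n := Nat.ceil_le.1 hnc
    rw [inv_le_iff_one_le_mul₀ (by positivity)] at h2
    simp only [Real.norm_natCast]
    refine abs_le_of_sq_le_sq' ?_ (by positivity) |>.2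
    nlinarith [Nat.cast_nonneg (α := ℝ) n]

theorem theorem1 (p : ℕ) [Fact p.Prime] (hp : p ≠ 2) (α : ℝ) (hα0 : 0 < α) (hα1 : α ≤ 1) :
    ∃ r s t : ℕ → ℝ,
      r =o[atTop] (fun n : ℕ => (n : ℝ)) ∧
      s =o[atTop] (fun n : ℕ => (n : ℝ)) ∧
      t =o[atTop] (fun n : ℕ => (p : ℝ) ^ n) ∧
      ∀ (n : ℕ), 1 ≤ n → ∀ [Fintype (GaloisField p n)] (S : Set (GaloisField p n)),
        α * (p : ℝ) ^ n ≤ (S.ncard : ℝ) →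
        (∀ T : Set (GaloisField p n),
          α * (p : ℝ) ^ n ≤ (T.ncard : ℝ) → Lambda3Set S ≤ Lambda3Set T) →
        ∃ (W : Submodule (ZMod p) (GaloisField p n)) (A : Set (GaloisField p n)),
          (n : ℝ) - r n ≤ (Module.finrank (ZMod p) W : ℝ) ∧
          A.Nonempty ∧ (A.ncard : ℝ) ≤ (p : ℝ) ^ (s n) ∧
          ((S ∆ (A + (W : Set (GaloisField p n)))).ncard : ℝ) ≤ t n := by
  choose K hK using fun i : ℕ => exists_bounded_codimension_approx p hp hα0 hα1
    (η := 1 / ((i : ℝ) + 1)) (by positivity)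
  obtain ⟨j, hj, hKj⟩ := exists_tendsto_isLittleO_comp K
  refine ⟨fun n => K (j n), fun n => K (j n), fun n => 1 / ((j n : ℝ) + 1) * (p : ℝ) ^ n,
    hKj, hKj, ?_, ?_⟩
  · have h1 : (fun n => 1 / ((j n : ℝ) + 1)) =o[atTop] fun _ => (1 : ℝ) :=
      (isLittleO_one_iff ℝ).2 (tendsto_one_div_add_atTop_nhds_zero_nat.comp hj)
    simpa using h1.mul_isBigO (isBigO_refl (fun n : ℕ => (p : ℝ) ^ n) atTop)
  intro n hn _ S hS hmin
  have hcard : (Fintype.card (GaloisField p n) : ℝ) = (p : ℝ) ^ n := by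
    rw [← Nat.card_eq_fintype_card, GaloisField.card p n (by omega), Nat.cast_pow]
  have hdim : Module.finrank (ZMod p) (GaloisField p n) = n := GaloisField.finrank p (by omega)
  rw [← hcard] at hS hmin
  obtain ⟨W, A, hW, hAne, hA, hSA⟩ := hK (j n) (GaloisField p n) S hS hmin
  refine ⟨W, A, ?_, hAne, ?_, ?_⟩
  · rw [hdim] at hW
    have : (n : ℝ) ≤ Module.finrank (ZMod p) W + K (j n) := by exact_mod_cast hW
    linarith
  · rw [Real.rpow_natCast]
    exact_mod_cast hA
  · rwa [hcard] at hSA
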